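/- Let $K$ be a field of characteristic zero and let $\mathbb{I}_1=K\langle x,\partial,\int\rangle$ be the algebra of polynomial integro-differential operators, i.e. the $K$-subalgebra of $\mathrm{End}_K(K[x])$ generated by multiplication by $x$, the derivation $\partial=\frac{d}{dx}$ and the integration $\int\colon x^n\mapsto \frac{x^{n+1}}{n+1}$ ($n\ge 0$). Put $H:=\partial x\in\mathbb{I}_1$. A left $\mathbb{I}_1$-module $M$ is called a generalized weight module if $M=\bigoplus_{\lambda\in K}M^\lambda$, where $M^\lambda:=\{m\in M \mid (H-\lambda)^n m=0 \text{ for some } n\ge 0\}$; it is called indecomposable if it is nonzero and is not the direct sum of two nonzero submodules. Then every indecomposable generalized weight $\mathbb{I}_1$-module is uniserial, i.e. for any two submodules $N,L$ of $M$ one has $N\subseteq L$ or $L\subseteq N$. -/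

import Mathlib

open Polynomial

noncomputable section

namespace IntegroDiff

/-- Integration `K[x] → K[x]`: the `K`-linear map with `x ^ n ↦ x ^ (n + 1) / (n + 1)`. -/
def integration (K : Type*) [Field K] : Module.End K K[X] :=
  Polynomial.lsum fun n : ℕ => ((n : K) + 1)⁻¹ • Polynomial.monomial (n + 1)

/-- Multiplication by `x` on `K[x]`. -/
def mulX (K : Type*) [Field K] : Module.End K K[X] :=
  LinearMap.mulLeft K (X : K[X])

/-- The algebra `K⟨x, d/dx, ∫⟩` of polynomial integro-differential operators, as a subalgebra of
the algebra of all `K`-linear endomorphisms of `K[x]`. -/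
def I₁ (K : Type*) [Field K] : Subalgebra K (Module.End K K[X]) :=
  Algebra.adjoin K {mulX K, Polynomial.derivative, integration K}

/-- The element `x` of the algebra. -/
def x (K : Type*) [Field K] : I₁ K :=
  ⟨mulX K, Algebra.subset_adjoin (by simp)⟩

/-- The element `∂ = d/dx` of the algebra. -/
def del (K : Type*) [Field K] : I₁ K :=
  ⟨Polynomial.derivative, Algebra.subset_adjoin (by simp)⟩

/-- The element `H = ∂ x` of the algebra. -/
def H (K : Type*) [Field K] : I₁ K :=
  del K * x K

section Modules

variable (K : Type*) [Field K] (M : Type*) [AddCommGroup M] [Module K M] [Module (I₁ K) M]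
  [IsScalarTower K (I₁ K) M]

/-- `M^c`, the set of all `m` with `(H - c) ^ n • m = 0` for some `n`
(see `mem_genWeightSpace`). -/
def genWeightSpace (c : K) : Submodule K M :=
  Module.End.maxGenEigenspace (Algebra.lsmul K K M (H K)) c

theorem mem_genWeightSpace (c : K) (m : M) :
    m ∈ genWeightSpace K M c ↔ ∃ n : ℕ, (H K - algebraMap K (I₁ K) c) ^ n • m = 0 := by
  have h : (Algebra.lsmul K K M (H K) : Module.End K M) - c • 1
      = Algebra.lsmul K K M (H K - algebraMap K (I₁ K) c) := by
    ext v
    simp only [LinearMap.sub_apply, LinearMap.smul_apply, Module.End.one_apply,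
      Algebra.lsmul_coe]
    refine Eq.trans ?_ (sub_smul (H K) (algebraMap K (I₁ K) c) v).symm
    rw [algebraMap_smul]
  simp only [genWeightSpace, Module.End.mem_maxGenEigenspace, h, ← map_pow,
    Algebra.lsmul_coe]

open Classical in
/-- `M` is the (internal) direct sum of the subspaces `M^c`, `c ∈ K`. -/
def IsGenWeight : Prop :=
  DirectSum.IsInternal fun c : K => genWeightSpace K M c

end Modules

/-- A nonzero module that is not the direct sum of two nonzero submodules. -/
def IsIndecomposable (R M : Type*) [Ring R] [AddCommGroup M] [Module R M] : Prop :=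
  Nontrivial M ∧ ∀ N L : Submodule R M, IsCompl N L → N = ⊥ ∨ L = ⊥

/-- The submodules form a chain. -/
def IsUniserial (R M : Type*) [Ring R] [AddCommGroup M] [Module R M] : Prop :=
  ∀ N L : Submodule R M, N ≤ L ∨ L ≤ N

end IntegroDiff

end

/-! Let `D`, `J`, `h` be the actions of `∂`, `∫`, `H`. Since `x = ∫ H`, submodules are the subspaces
stable under these three operators, and only the identities in `Relations` matter. There are two
cases, according to whether `D` has a kernel.

If `D v = 0` with `v ≠ 0`, a formal Taylor expansion `m ↦ ∑ g (D ^ n m) • J ^ n v` is an idempotent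
endomorphism of the module. Its range and kernel are complementary submodules, so indecomposability
makes it the identity. Thus `M` is a copy of `K[x]`, which is simple (`simple_of_ker`).

If `D` is injective, then `J = D⁻¹`, the weights fill a single coset `c + ℤ`, and a submodule is
determined by its part of weight `c`. Indecomposability passes to `M^c` with the locally nilpotent
operator `t = h - c` (`chain_of_injective`). The same kind of expansion along a Jordan chain of `t`
is again an injective projection, which forces `ker t` to have dimension at most one. The invariant
subspaces of `t` then form a chain (`chain_of_locally_nilpotent`). -/

namespace IntegroDiff

/-! ### Projections given by expansion along a chain of vectors -/

section ShiftProjection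

variable {K V : Type*} [Field K] [AddCommGroup V] [Module K V]

/-- The map `m ↦ ∑ n, f (t ^ n m) • v n`, where for each `m` only finitely many coefficients are
nonzero. -/
noncomputable def shiftProj (t : Module.End K V) (f : V →ₗ[K] K) (v : ℕ → V)
    (hfin : ∀ m, {n : ℕ | f ((t ^ n) m) ≠ 0}.Finite) : Module.End K V where
  toFun m := ∑ᶠ n, f ((t ^ n) m) • v n
  map_add' a b := by
    rw [← finsum_add_distrib]
    · simp [add_smul]
    · exact (hfin a).subset fun n hn h => hn (by simp [h])
    · exact (hfin b).subset fun n hn h => hn (by simp [h])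
  map_smul' c a := by
    rw [RingHom.id_apply, smul_finsum' c ((hfin a).subset fun n hn h => hn (by simp [h]))]
    simp [mul_smul]

variable {t : Module.End K V} {f : V →ₗ[K] K} {v : ℕ → V}
  {hfin : ∀ m, {n : ℕ | f ((t ^ n) m) ≠ 0}.Finite}

theorem shiftProj_apply (m : V) :
    shiftProj t f v hfin m = ∑ᶠ n, f ((t ^ n) m) • v n := rfl

theorem finite_support_shiftProj (hfin : ∀ m, {n : ℕ | f ((t ^ n) m) ≠ 0}.Finite) (v : ℕ → V)
    (m : V) : (Function.support fun n => f ((t ^ n) m) • v n).Finite :=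
  (hfin m).subset fun n hn h => hn (by simp [h])

theorem map_shiftProj {W : Type*} [AddCommGroup W] [Module K W] (g : V →ₗ[K] W) (m : V) :
    g (shiftProj t f v hfin m) = ∑ᶠ n, f ((t ^ n) m) • g (v n) := by
  have h := AddMonoidHom.map_finsum g.toAddMonoidHom (finite_support_shiftProj hfin v m)
  simpa [shiftProj_apply] using h

theorem finsum_nat_eq_of_zero {W : Type*} [AddCommMonoid W] {u w : ℕ → W} (hu : u 0 = 0)
    (h : ∀ n, u (n + 1) = w n) : ∑ᶠ n, u n = ∑ᶠ n, w n := by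
  have h1 : (∑ᶠ n, w n) = ∑ᶠ n, u (n + 1) := by simp [h]
  rw [h1, ← finsum_mem_range (f := u) (g := fun n => n + 1) (add_left_injective 1),
    finsum_mem_def]
  refine finsum_congr fun n => ?_
  rcases n with - | n
  · simp [hu]
  · simp

/-- Applying `t` moves each `v (i + 1)` to `v i` and kills `v 0`, so it only reindexes the sum. The
relation is weighted by the coefficients so that a finite chain, padded with zeros, also qualifies.
-/
theorem shiftProj_comm (h0 : t (v 0) = 0)
    (hs : ∀ m i, f ((t ^ (i + 1)) m) • t (v (i + 1)) = f ((t ^ (i + 1)) m) • v i) (m : V) :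
    shiftProj t f v hfin (t m) = t (shiftProj t f v hfin m) := by
  rw [map_shiftProj, shiftProj_apply]
  refine (finsum_nat_eq_of_zero (by simp [h0]) fun n => ?_).symm
  rw [hs, pow_succ, Module.End.mul_apply]

theorem apply_shiftProj (h0 : f (v 0) = 1) (hv : ∀ i, f (v (i + 1)) = 0) (m : V) :
    f (shiftProj t f v hfin m) = f m := by
  rw [map_shiftProj, finsum_eq_single _ 0]
  · simp [h0]
  · intro n hn
    obtain ⟨n, rfl⟩ := Nat.exists_eq_succ_of_ne_zero hn
    simp [hv]

/-- The projection commutes with powers of `t` and preserves `f`, so `m` and its image have the same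
coefficients. -/
theorem shiftProj_idem
    (hc : ∀ m, shiftProj t f v hfin (t m) = t (shiftProj t f v hfin m))
    (h0 : f (v 0) = 1) (hv : ∀ i, f (v (i + 1)) = 0) (m : V) :
    shiftProj t f v hfin (shiftProj t f v hfin m) = shiftProj t f v hfin m := by
  have hp : ∀ n m, shiftProj t f v hfin ((t ^ n) m) = (t ^ n) (shiftProj t f v hfin m) := by
    intro n
    induction n with
    | zero => simp
    | succ n ih => intro m; rw [pow_succ, Module.End.mul_apply, ih, hc, Module.End.mul_apply]
  conv_lhs => rw [shiftProj_apply]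
  conv_rhs => rw [shiftProj_apply]
  refine finsum_congr fun n => ?_
  rw [← hp, apply_shiftProj h0 hv]

/-- A projection onto a nonzero subspace that commutes with a family of operators is injective,
provided that the family has no two nonzero complementary invariant subspaces. -/
theorem eq_zero_of_idem {P : Submodule K V → Prop}
    (hP : ∀ A B : Submodule K V, P A → P B → IsCompl A B → A = ⊥ ∨ B = ⊥)
    (π : Module.End K V) (hidem : ∀ m, π (π m) = π m) (hr : P (LinearMap.range π))
    (hk : P (LinearMap.ker π)) {w : V} (hw : π w ≠ 0) {m : V} (hm : π m = 0) : m = 0 := by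
  have hi : IsIdempotentElem π := LinearMap.ext hidem
  rcases hP _ _ hr hk (LinearMap.IsIdempotentElem.isCompl hi) with h | h
  · exact absurd (LinearMap.congr_fun (LinearMap.range_eq_bot.1 h) w) hw
  · exact (Submodule.mem_bot K).1 (h ▸ (LinearMap.mem_ker.2 hm))

end ShiftProjection

/-! ### Locally nilpotent operators -/

section Nilpotent

variable {K V : Type*} [Field K] [AddCommGroup V] [Module K V] {t : Module.End K V}

/-- When `ker t` is at most a line, the top powers of `v` and `w` are proportional. Subtracting a
multiple of `v` from `w` lowers its nilpotency order, and `t v` then serves in place of `v`. -/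
theorem mem_of_pow_ne_zero
    (h1 : ∀ v w : V, t v = 0 → t w = 0 → v ≠ 0 → ∃ c : K, w = c • v)
    {A : Submodule K V} (hA : ∀ a ∈ A, t a ∈ A) (n : ℕ) :
    ∀ v w : V, v ∈ A → (t ^ n) v ≠ 0 → (t ^ (n + 1)) v = 0 → (t ^ (n + 1)) w = 0 → w ∈ A := by
  induction n with
  | zero =>
    intro v w hv hv0 hv1 hw
    obtain ⟨c, rfl⟩ := h1 v w (by simpa using hv1) (by simpa using hw) (by simpa using hv0)
    exact A.smul_mem c hv
  | succ n ih =>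
    intro v w hv hv0 hv1 hw
    obtain ⟨c, hc⟩ := h1 ((t ^ (n + 1)) v) ((t ^ (n + 1)) w)
      (by rw [← Module.End.mul_apply, ← pow_succ', hv1])
      (by rw [← Module.End.mul_apply, ← pow_succ', hw]) hv0
    have := ih (t v) (w - c • v) (hA v hv)
      (by rwa [← Module.End.mul_apply, ← pow_succ])
      (by rwa [← Module.End.mul_apply, ← pow_succ]) (by simp [hc])
    simpa using A.add_mem this (A.smul_mem c hv)

theorem chain_of_ker_le_one (hnil : ∀ v, ∃ n, (t ^ n) v = 0)
    (h1 : ∀ v w : V, t v = 0 → t w = 0 → v ≠ 0 → ∃ c : K, w = c • v)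
    {A B : Submodule K V} (hA : ∀ a ∈ A, t a ∈ A) (hB : ∀ a ∈ B, t a ∈ B) : A ≤ B ∨ B ≤ A := by
  by_contra! hcon
  obtain ⟨a, haA, haB⟩ := SetLike.not_le_iff_exists.1 hcon.1
  obtain ⟨b, hbB, hbA⟩ := SetLike.not_le_iff_exists.1 hcon.2
  have key : ∀ v : V, v ≠ 0 → ∃ n, (t ^ n) v ≠ 0 ∧ (t ^ (n + 1)) v = 0 := by
    classical
    intro v hv
    have hpos : Nat.find (hnil v) ≠ 0 := fun h => hv (by
      have := Nat.find_spec (hnil v)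
      rwa [h, pow_zero, Module.End.one_apply] at this)
    obtain ⟨n, hn⟩ := Nat.exists_eq_succ_of_ne_zero hpos
    exact ⟨n, Nat.find_min (hnil v) (by omega), by
      have := Nat.find_spec (hnil v)
      rwa [hn] at this⟩
  obtain ⟨i, hi, hi'⟩ := key a fun h => haB (h ▸ B.zero_mem)
  obtain ⟨j, hj, hj'⟩ := key b fun h => hbA (h ▸ A.zero_mem)
  rcases le_total i j with hij | hij
  · exact haB (mem_of_pow_ne_zero h1 hB j b a hbB hj hj'
      (Module.End.pow_map_zero_of_le (by omega) hi'))
  · exact hbA (mem_of_pow_ne_zero h1 hA i a b haA hi hi'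
      (Module.End.pow_map_zero_of_le (by omega) hj'))

/-- It suffices that `v 0` lies outside the span of `R` and the later `v i`. In a relation whose
last chain term is `c • v (n + 1)`, applying `t ^ (n + 1)` kills `v 0` and the earlier terms and
leaves `c • v 0 ∈ R`. -/
theorem exists_functional {R : Submodule K V} (hR : ∀ a ∈ R, t a ∈ R) {v : ℕ → V}
    (h0 : t (v 0) = 0) (hv : ∀ i, v i = 0 ∨ (t ^ i) (v i) = v 0) (hv0 : v 0 ∉ R) :
    ∃ f : V →ₗ[K] K, f (v 0) = 1 ∧ (∀ i, f (v (i + 1)) = 0) ∧ ∀ r ∈ R, f r = 0 := by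
  have hRn : ∀ n, ∀ a ∈ R, (t ^ n) a ∈ R := by
    intro n
    induction n with
    | zero => simp
    | succ n ih => intro a ha; rw [pow_succ, Module.End.mul_apply]; exact ih _ (hR a ha)
  have hz : ∀ i, (t ^ (i + 1)) (v i) = 0 := by
    intro i
    rcases hv i with h | h
    · simp [h]
    · rw [pow_succ', Module.End.mul_apply, h, h0]
  have hn : ∀ n, v 0 ∉ R ⊔ Submodule.span K ((fun i => v (i + 1)) '' Set.Iio n) := by
    intro n
    induction n with
    | zero => simpa using hv0
    | succ n ih =>
      intro hmem
      have hS : Set.Iio (n + 1) = insert n (Set.Iio n) := by ext; simp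
      rw [hS, Set.image_insert_eq, Submodule.span_insert, ← sup_assoc, sup_right_comm] at hmem
      obtain ⟨y, hy, z, hz', hyz⟩ := Submodule.mem_sup.1 hmem
      obtain ⟨c, rfl⟩ := Submodule.mem_span_singleton.1 hz'
      by_cases hc : c • v (n + 1) = 0
      · exact ih (by rw [← hyz, hc, add_zero]; exact hy)
      · have hvn : (t ^ (n + 1)) (v (n + 1)) = v 0 :=
          (hv (n + 1)).resolve_left fun h => hc (by simp [h])
        have hc0 : c ≠ 0 := fun h => hc (by simp [h])
        obtain ⟨r, hr, s, hs, rfl⟩ := Submodule.mem_sup.1 hy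
        have hs0 : (t ^ (n + 1)) s = 0 := by
          have : Submodule.span K ((fun i => v (i + 1)) '' Set.Iio n) ≤
              LinearMap.ker (t ^ (n + 1)) := by
            rw [Submodule.span_le]
            rintro _ ⟨i, hi, rfl⟩
            exact Module.End.pow_map_zero_of_le (by simpa using hi) (hz (i + 1))
          exact this hs
        have hvz : (t ^ (n + 1)) (v 0) = 0 :=
          Module.End.pow_map_zero_of_le (by omega) (hz 0)
        have := congrArg (t ^ (n + 1)) hyz
        rw [map_add, map_add, map_smul, hs0, hvn, hvz, add_zero] at this
        have h2 : c • v 0 ∈ R := by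
          rw [eq_neg_of_add_eq_zero_right this]
          exact R.neg_mem (hRn _ _ hr)
        exact hv0 ((R.smul_mem_iff hc0).1 h2)
  have hall : v 0 ∉ R ⊔ Submodule.span K (Set.range fun i => v (i + 1)) := by
    intro hmem
    obtain ⟨r, hr, s, hs, hrs⟩ := Submodule.mem_sup.1 hmem
    have : ∃ n, s ∈ Submodule.span K ((fun i => v (i + 1)) '' Set.Iio n) := by
      clear hrs
      induction hs using Submodule.span_induction with
      | mem x hx =>
        obtain ⟨i, rfl⟩ := hx
        exact ⟨i + 1, Submodule.subset_span ⟨i, by simp, rfl⟩⟩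
      | zero => exact ⟨0, Submodule.zero_mem _⟩
      | add x y _ _ hx hy =>
        obtain ⟨a, ha⟩ := hx
        obtain ⟨b, hb⟩ := hy
        exact ⟨max a b, Submodule.add_mem _
          (Submodule.span_mono (Set.image_mono (Set.Iio_subset_Iio (le_max_left a b))) ha)
          (Submodule.span_mono (Set.image_mono (Set.Iio_subset_Iio (le_max_right a b))) hb)⟩
      | smul c x _ hx =>
        obtain ⟨a, ha⟩ := hx
        exact ⟨a, Submodule.smul_mem _ c ha⟩
    obtain ⟨n, hsn⟩ := this
    exact hn n (hrs ▸ Submodule.add_mem_sup hr hsn)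
  obtain ⟨g, hg, hgk⟩ := Submodule.exists_le_ker_of_notMem hall
  refine ⟨(g (v 0))⁻¹ • g, by simp [hg], fun i => ?_, fun r hr => ?_⟩
  · have : g (v (i + 1)) = 0 :=
      hgk (Submodule.mem_sup_right (Submodule.subset_span ⟨i, rfl⟩))
    simp [this]
  · have : g r = 0 := hgk (Submodule.mem_sup_left hr)
    simp [this]

/-- A locally nilpotent operator has a Jordan chain, infinite or of maximal length, together with a
functional that satisfies the hypotheses of `shiftProj_comm` and `apply_shiftProj`. -/
theorem exists_jordan_chain [Nontrivial V] (hnil : ∀ v, ∃ n, (t ^ n) v = 0) :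
    ∃ (f : V →ₗ[K] K) (v : ℕ → V), t (v 0) = 0 ∧ f (v 0) = 1 ∧ (∀ i, f (v (i + 1)) = 0) ∧
      ∀ m i, f ((t ^ (i + 1)) m) • t (v (i + 1)) = f ((t ^ (i + 1)) m) • v i := by
  have hex : ∃ z : V, z ≠ 0 ∧ t z = 0 := by
    by_contra! hcon
    obtain ⟨m, hm⟩ := exists_ne (0 : V)
    obtain ⟨n, hn⟩ := hnil m
    have : ∀ n, (t ^ n) m ≠ 0 := by
      intro n
      induction n with
      | zero => simpa using hm
      | succ n ih => rw [pow_succ', Module.End.mul_apply]; exact hcon _ ih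
    exact this n hn
  -- If every kernel vector is infinitely divisible, `t` is surjective and an infinite chain exists.
  -- Otherwise some kernel vector has finite height `j`, and the chain stops there.
  by_cases hdiv : ∀ z, t z = 0 → ∀ n, z ∈ LinearMap.range (t ^ n)
  · have hsurj : ∀ n m, (t ^ n) m = 0 → ∃ w, t w = m := by
      intro n
      induction n with
      | zero => intro m hm; exact ⟨0, by simpa using hm.symm⟩
      | succ n ih =>
        intro m hm
        obtain ⟨w, hw⟩ := hdiv ((t ^ n) m)
          (by rw [← Module.End.mul_apply, ← pow_succ', hm]) (n + 1)
        obtain ⟨u, hu⟩ := ih (m - t w)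
          (by rw [map_sub, ← Module.End.mul_apply, ← pow_succ, hw, sub_self])
        exact ⟨u + w, by rw [map_add, hu, sub_add_cancel]⟩
    choose g hg using fun m => (hnil m).elim fun n hn => hsurj n m hn
    obtain ⟨z, hz, htz⟩ := hex
    let v : ℕ → V := fun n => g^[n] z
    have hv : ∀ i, t (v (i + 1)) = v i := fun i => by
      simp only [v, Function.iterate_succ_apply', hg]
    have hvi : ∀ i, (t ^ i) (v i) = v 0 := by
      intro i
      induction i with
      | zero => simp
      | succ i ih => rw [pow_succ, Module.End.mul_apply, hv, ih]
    obtain ⟨f, hf0, hf, -⟩ := exists_functional (t := t) (R := ⊥) (by simp) (v := v) htz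
      (fun i => Or.inr (hvi i)) (by simpa [v] using hz)
    exact ⟨f, v, htz, hf0, hf, fun m i => by rw [hv]⟩
  · push Not at hdiv
    obtain ⟨z, htz, hdiv⟩ := hdiv
    classical
    have hpos : Nat.find hdiv ≠ 0 := fun h => by
      have := Nat.find_spec hdiv
      rw [h] at this
      exact this ⟨z, by simp⟩
    obtain ⟨j, hj⟩ := Nat.exists_eq_succ_of_ne_zero hpos
    have hj' : z ∉ LinearMap.range (t ^ (j + 1)) := by
      have := Nat.find_spec hdiv
      rwa [hj] at this
    obtain ⟨u, hu⟩ : z ∈ LinearMap.range (t ^ j) :=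
      not_not.1 (Nat.find_min hdiv (m := j) (by omega))
    -- Past `j` the chain is padded with zeros. This is harmless because `f` will vanish on the
    -- range of `t ^ (j + 1)`.
    let v : ℕ → V := fun i => if i ≤ j then (t ^ (j - i)) u else 0
    have hv0 : v 0 = z := by simp [v, hu]
    obtain ⟨f, hf0, hf, hfR⟩ := exists_functional (t := t) (R := LinearMap.range (t ^ (j + 1)))
      (by
        rintro _ ⟨a, rfl⟩
        exact ⟨t a, by rw [← Module.End.mul_apply, ← Module.End.mul_apply, ← pow_succ, pow_succ']⟩)
      (v := v) (by rw [hv0, htz])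
      (fun i => by
        by_cases hi : i ≤ j
        · right
          rw [hv0]
          simp only [v, hi, if_true]
          rw [← Module.End.mul_apply, ← pow_add, Nat.add_sub_cancel' hi, hu]
        · left; simp [v, hi])
      (by rwa [hv0])
    refine ⟨f, v, by rw [hv0, htz], hf0, hf, fun m i => ?_⟩
    by_cases hi : i + 1 ≤ j
    · congr 1
      have hi' : i ≤ j := by omega
      simp only [v, hi, hi', if_true]
      rw [← Module.End.mul_apply, ← pow_succ']
      congr 2
      omega
    · have : f ((t ^ (i + 1)) m) = 0 := hfR _
        ⟨(t ^ (i - j)) m, by rw [← Module.End.mul_apply, ← pow_add]; congr 2; omega⟩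
      simp [this]

/-- The invariant subspaces of a locally nilpotent operator form a chain if no two nonzero ones
are complementary. -/
theorem chain_of_locally_nilpotent (hnil : ∀ v, ∃ n, (t ^ n) v = 0)
    (hind : ∀ A B : Submodule K V, (∀ a ∈ A, t a ∈ A) → (∀ a ∈ B, t a ∈ B) → IsCompl A B →
      A = ⊥ ∨ B = ⊥)
    {A B : Submodule K V} (hA : ∀ a ∈ A, t a ∈ A) (hB : ∀ a ∈ B, t a ∈ B) : A ≤ B ∨ B ≤ A := by
  rcases subsingleton_or_nontrivial V with _ | _
  · exact Or.inl fun a _ => by rw [Subsingleton.elim a 0]; exact B.zero_mem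
  obtain ⟨f, v, h0, hf0, hf, hs⟩ := exists_jordan_chain hnil
  have hfin : ∀ m, {n : ℕ | f ((t ^ n) m) ≠ 0}.Finite := by
    intro m
    obtain ⟨N, hN⟩ := hnil m
    refine (Set.finite_Iio N).subset fun n hn => ?_
    by_contra hcon
    exact hn (by rw [Module.End.pow_map_zero_of_le (by simpa using hcon) hN, map_zero])
  have hc := shiftProj_comm (hfin := hfin) h0 hs
  have hinj : ∀ m, shiftProj t f v hfin m = 0 → m = 0 := fun m =>
    eq_zero_of_idem (P := fun A => ∀ a ∈ A, t a ∈ A) hind _ (shiftProj_idem hc hf0 hf)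
      (by rintro _ ⟨a, rfl⟩; exact ⟨t a, hc a⟩)
      (fun a ha => by rw [LinearMap.mem_ker] at ha ⊢; rw [hc, ha, map_zero])
      (w := v 0) (fun h => by
        have := apply_shiftProj (hfin := hfin) hf0 hf (v 0)
        rw [h, map_zero, hf0] at this
        exact zero_ne_one this)
  -- On `ker t` the expansion reduces to its term `f m • v 0`, so `f` is injective there.
  have hker : ∀ m, t m = 0 → f m = 0 → m = 0 := by
    intro m hm hfm
    refine hinj m ?_
    rw [shiftProj_apply]
    refine finsum_eq_zero_of_forall_eq_zero fun n => ?_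
    rcases n with - | n
    · simp [hfm]
    · rw [pow_succ, Module.End.mul_apply, hm]; simp
  refine chain_of_ker_le_one hnil (fun a b ha hb ha0 => ?_) hA hB
  have hfa : f a ≠ 0 := fun h => ha0 (hker a ha h)
  refine ⟨f b / f a, sub_eq_zero.1 (hker _ (by simp [ha, hb]) ?_)⟩
  simp [hfa]

end Nilpotent

/-! ### The three operators, and the case where `D` has a kernel -/

section Operators

variable {K M : Type*} [Field K] [AddCommGroup M] [Module K M]

/-- In `M ⧸ p` the images of the components of `m` are generalized eigenvectors with sum zero, so
each vanishes by independence. -/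
theorem mem_iSup_inf_maxGenEigenspace {h : Module.End K M}
    (hsup : ⨆ μ, h.maxGenEigenspace μ = ⊤) {p : Submodule K M} (hp : ∀ x ∈ p, h x ∈ p) {m : M}
    (hm : m ∈ p) : m ∈ ⨆ μ, p ⊓ h.maxGenEigenspace μ := by
  classical
  obtain ⟨c, hc, rfl⟩ := (Submodule.mem_iSup_iff_exists_finsupp _ _).1
    (hsup ▸ Submodule.mem_top : m ∈ ⨆ μ, h.maxGenEigenspace μ)
  refine (Submodule.mem_iSup_iff_exists_finsupp _ _).2 ⟨c, fun μ => ⟨?_, hc μ⟩, rfl⟩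
  let hq : Module.End K (M ⧸ p) := p.mapQ p h hp
  have hpow : ∀ (μ : K) (k : ℕ) (x : M), ((hq - μ • 1) ^ k) (p.mkQ x) =
      p.mkQ (((h - μ • 1) ^ k) x) := by
    intro μ k
    induction k with
    | zero => simp
    | succ k ih =>
      intro x
      rw [pow_succ, Module.End.mul_apply, pow_succ, Module.End.mul_apply, ← ih]
      simp [hq]
  have hmem : ∀ μ, p.mkQ (c μ) ∈ hq.maxGenEigenspace μ := by
    intro μ
    obtain ⟨k, hk⟩ := (Module.End.mem_maxGenEigenspace _ _ _).1 (hc μ)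
    exact (Module.End.mem_maxGenEigenspace _ _ _).2 ⟨k, by rw [hpow, hk, map_zero]⟩
  have hsum : ∑ μ ∈ c.support, p.mkQ (c μ) = 0 := by
    rw [← map_sum]
    exact (Submodule.Quotient.mk_eq_zero p).2 hm
  by_cases hμ : μ ∈ c.support
  · have := (iSupIndep_iff_finsetSum_eq_zero_imp_eq_zero _).1 hq.independent_maxGenEigenspace
      c.support (fun μ => p.mkQ (c μ)) (fun μ _ => hmem μ) hsum μ hμ
    simpa using this
  · rw [Finsupp.notMem_support_iff.1 hμ]; exact p.zero_mem

/-- The relations between the actions `D`, `J`, `h` of differentiation, integration and `H`. -/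
structure Relations (D J h : Module.End K M) : Prop where
  DJ : ∀ m, D (J m) = m
  Dh : ∀ m, D (h m) = h (D m) + D m
  hJ : ∀ m, h (J m) = J (h m) + J m
  he : ∀ m, h (m - J (D m)) = m - J (D m)

/-- Invariance under the three operators. -/
def Stable (D J h : Module.End K M) (S : Submodule K M) : Prop :=
  ∀ m ∈ S, D m ∈ S ∧ J m ∈ S ∧ h m ∈ S

/-- No two nonzero complementary invariant subspaces. -/
def Indecomp (D J h : Module.End K M) : Prop :=
  ∀ A B : Submodule K M, Stable D J h A → Stable D J h B → IsCompl A B → A = ⊥ ∨ B = ⊥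

variable {D J h : Module.End K M}

namespace Relations

theorem pow_D_h (R : Relations D J h) (n : ℕ) (m : M) :
    (D ^ n) (h m) = h ((D ^ n) m) + (n : K) • (D ^ n) m := by
  induction n with
  | zero => simp
  | succ n ih =>
    rw [pow_succ', Module.End.mul_apply, ih, map_add, R.Dh, map_smul, Module.End.mul_apply,
      Nat.cast_succ, add_smul, one_smul]
    abel

theorem h_pow_J (R : Relations D J h) {v : M} (hv : h v = v) (n : ℕ) :
    h ((J ^ n) v) = ((n : K) + 1) • (J ^ n) v := by
  induction n with
  | zero => simp [hv]
  | succ n ih =>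
    rw [pow_succ', Module.End.mul_apply, R.hJ, ih, map_smul, Nat.cast_succ,
      add_smul ((n : K) + 1) 1, one_smul]

theorem eh (R : Relations D J h) (m : M) : h m - J (D (h m)) = m - J (D m) := by
  rw [R.Dh, map_add, ← R.hJ, ← map_sub, R.he]

/-- By `pow_D_h` and `eh`, the functional `m ↦ f ((1 - J D) (D ^ n m))` is an eigenvector of the
transpose of `h` with eigenvalue `n + 1`. It kills every generalized weight space except that of
weight `n + 1`. -/
theorem finite_coeff [CharZero K] (R : Relations D J h) (hsup : ⨆ μ, h.maxGenEigenspace μ = ⊤)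
    (f : M →ₗ[K] K) (m : M) :
    {n : ℕ | (f ∘ₗ (1 - J * D)) ((D ^ n) m) ≠ 0}.Finite := by
  have hm : m ∈ ⨆ μ, h.maxGenEigenspace μ := hsup ▸ Submodule.mem_top
  induction hm using Submodule.iSup_induction' with
  | zero => simp
  | add x y _ _ hx hy =>
    refine (hx.union hy).subset fun n hn => ?_
    by_contra hcon
    simp only [Set.mem_union, Set.mem_ofPred_eq, not_or, not_not] at hcon
    exact hn (by rw [map_add, map_add, hcon.1, hcon.2, add_zero])
  | mem μ x hx =>
    obtain ⟨k, hk⟩ := (Module.End.mem_maxGenEigenspace _ _ _).1 hx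
    refine Set.Subsingleton.finite ?_
    have key : ∀ n : ℕ, (f ∘ₗ (1 - J * D)) ((D ^ n) x) ≠ 0 → (n : K) + 1 = μ := by
      intro n hn
      by_contra hne
      have hpow : ∀ (k : ℕ) (y : M), (f ∘ₗ (1 - J * D)) ((D ^ n) (((h - μ • 1) ^ k) y)) =
          ((n : K) + 1 - μ) ^ k * (f ∘ₗ (1 - J * D)) ((D ^ n) y) := by
        intro k
        induction k with
        | zero => simp
        | succ k ih =>
          intro y
          rw [pow_succ, Module.End.mul_apply, ih]
          have h1 : (f ∘ₗ (1 - J * D)) ((D ^ n) ((h - μ • 1) y)) =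
              ((n : K) + 1 - μ) * (f ∘ₗ (1 - J * D)) ((D ^ n) y) := by
            have h2 := congrArg f (R.eh ((D ^ n) y))
            simp only [map_sub] at h2
            simp only [LinearMap.sub_apply, LinearMap.smul_apply, Module.End.one_apply, map_sub,
              map_smul, R.pow_D_h, map_add, LinearMap.comp_apply, Module.End.mul_apply,
              smul_eq_mul]
            linear_combination h2
          rw [h1]; ring
      have := hpow k x
      rw [hk, map_zero, map_zero] at this
      exact mul_ne_zero (pow_ne_zero k (sub_ne_zero.2 hne)) hn this.symm
    intro a ha b hb
    have := (key a ha).trans (key b hb).symm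
    exact_mod_cast add_right_cancel this

/-- If differentiation has a kernel, then there are no proper nonzero invariant subspaces. -/
theorem simple_of_ker [CharZero K] (R : Relations D J h)
    (hsup : ⨆ μ, h.maxGenEigenspace μ = ⊤) (hind : Indecomp D J h) {v : M} (hv : v ≠ 0)
    (hDv : D v = 0) {S : Submodule K M} (hS : Stable D J h S) : S = ⊥ ∨ S = ⊤ := by
  obtain ⟨f, hfv⟩ : ∃ f : M →ₗ[K] K, f v = 1 := by
    obtain ⟨g, hg, -⟩ := Submodule.exists_le_ker_of_notMem (p := (⊥ : Submodule K M))
      (by simpa using hv)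
    exact ⟨(g v)⁻¹ • g, by simp [hg]⟩
  have hhv : h v = v := by simpa [hDv] using R.he v
  have hfin := R.finite_coeff hsup f
  set g : M →ₗ[K] K := f ∘ₗ (1 - J * D) with hg
  have gdef : ∀ m, g m = f m - f (J (D m)) := fun m => by simp [hg]
  set u : ℕ → M := fun n => (J ^ n) v with hu
  have hu0 : u 0 = v := by simp [hu]
  have hus : ∀ n, u (n + 1) = J (u n) := fun n => by
    simp only [hu]; rw [pow_succ', Module.End.mul_apply]
  have gJ : ∀ m, g (J m) = 0 := fun m => by rw [gdef, R.DJ, sub_self]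
  have gu0 : g (u 0) = 1 := by rw [gdef, hu0, hDv]; simp [hfv]
  have gus : ∀ i, g (u (i + 1)) = 0 := fun i => by rw [hus, gJ]
  set π := shiftProj D g u hfin with hπ
  have hD : ∀ m, π (D m) = D (π m) := shiftProj_comm (by rw [hu0, hDv])
    fun m i => by rw [hus, R.DJ]
  have hJ : ∀ m, π (J m) = J (π m) := by
    intro m
    rw [hπ, map_shiftProj, shiftProj_apply]
    refine finsum_nat_eq_of_zero (by simp [gJ]) fun n => ?_
    rw [pow_succ, Module.End.mul_apply, R.DJ, hus]
  have hh : ∀ m, π (h m) = h (π m) := by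
    intro m
    rw [hπ, map_shiftProj, shiftProj_apply]
    refine finsum_congr fun n => ?_
    have : g (h ((D ^ n) m)) = g ((D ^ n) m) := by
      rw [gdef, gdef, ← map_sub, ← map_sub, R.eh]
    rw [R.h_pow_J hhv, R.pow_D_h, map_add, map_smul, this, smul_smul]
    congr 1
    rw [smul_eq_mul]; ring
  have hidem : ∀ m, π (π m) = π m := shiftProj_idem hD gu0 gus
  have hinj : ∀ m, π m = 0 → m = 0 := fun m =>
    eq_zero_of_idem hind π hidem
      (by rintro _ ⟨a, rfl⟩; exact ⟨⟨_, hD a⟩, ⟨_, hJ a⟩, ⟨_, hh a⟩⟩)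
      (fun a ha => by
        rw [LinearMap.mem_ker] at ha
        refine ⟨?_, ?_, ?_⟩ <;> rw [LinearMap.mem_ker]
        · rw [hD, ha, map_zero]
        · rw [hJ, ha, map_zero]
        · rw [hh, ha, map_zero])
      (w := u 0) (fun h0 => by
        have := apply_shiftProj (hfin := hfin) gu0 gus (u 0)
        rw [← hπ, h0, map_zero, gu0] at this
        exact zero_ne_one this)
  -- An injective idempotent is the identity.
  have hid : ∀ m, π m = m := fun m => by
    have := hinj (π m - m) (by rw [map_sub, hidem, sub_self])
    exact sub_eq_zero.1 this
  have hcoef : ∀ m, (∀ n, g ((D ^ n) m) = 0) → m = 0 := fun m hm => hinj m (by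
    rw [hπ, shiftProj_apply]
    exact finsum_eq_zero_of_forall_eq_zero fun n => by rw [hm, zero_smul])
  -- Both sides have the same coefficients, because `D (1 - J D) = 0`. So `1 - J D` has rank one and
  -- extracts `v` from any vector with a nonzero coefficient.
  have he : ∀ m, m - J (D m) = g m • v := by
    intro m
    refine sub_eq_zero.1 (hcoef _ fun n => ?_)
    rcases n with - | n
    · rw [← hu0, pow_zero, Module.End.one_apply, map_sub, map_sub, gJ, map_smul, gu0]
      simp
    · rw [pow_succ, Module.End.mul_apply, map_sub D, map_sub D, R.DJ, map_smul, hDv]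
      simp
  rcases eq_or_ne S ⊥ with h0 | h0
  · exact Or.inl h0
  right
  obtain ⟨m, hmS, hm0⟩ := Submodule.exists_mem_ne_zero_of_ne_bot h0
  obtain ⟨n, hn⟩ : ∃ n, g ((D ^ n) m) ≠ 0 := by
    by_contra! hcon
    exact hm0 (hcoef m hcon)
  have hDn : ∀ n, (D ^ n) m ∈ S := by
    intro n
    induction n with
    | zero => simpa using hmS
    | succ n ih => rw [pow_succ', Module.End.mul_apply]; exact (hS _ ih).1
  have hvS : v ∈ S := by
    have h1 := S.sub_mem (hDn n) (hS _ (hS _ (hDn n)).1).2.1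
    rw [he] at h1
    exact (S.smul_mem_iff hn).1 h1
  have huS : ∀ n, u n ∈ S := by
    intro n
    induction n with
    | zero => rwa [hu0]
    | succ n ih => rw [hus]; exact (hS _ ih).2.1
  refine eq_top_iff.2 fun a _ => ?_
  rw [← hid a, hπ, shiftProj_apply]
  exact finsum_induction (· ∈ S) S.zero_mem (fun _ _ => S.add_mem)
    fun n => S.smul_mem _ (huS n)

end Relations

end Operators

/-! ### The case where `D` is injective -/

section Shift

variable {K M : Type*} [Field K] [AddCommGroup M] [Module K M] {D J h : Module.End K M}

namespace Relations

/-- Injectivity makes `J` a two-sided inverse of `D`, and `T n` is `D ^ n` for integer `n`; it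
lowers weights by `n`. -/
theorem exists_zpow (R : Relations D J h) (hinj : ∀ m, D m = 0 → m = 0) :
    ∃ T : ℤ → Module.End K M, T 1 = D ∧ T (-1) = J ∧ (∀ m, T 0 m = m) ∧
      (∀ a b m, T (a + b) m = T a (T b m)) ∧
      ∀ (n : ℤ) m, T n (h m) = h (T n m) + (n : K) • T n m := by
  have hJD : ∀ m, J (D m) = m := fun m =>
    sub_eq_zero.1 (hinj _ (by rw [map_sub, R.DJ, sub_self]))
  let U : (Module.End K M)ˣ := ⟨D, J, LinearMap.ext R.DJ, LinearMap.ext hJD⟩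
  have hadd : ∀ (a b : ℤ) m, ((U ^ (a + b) : (Module.End K M)ˣ) : Module.End K M) m =
      ((U ^ a : (Module.End K M)ˣ) : Module.End K M)
        (((U ^ b : (Module.End K M)ˣ) : Module.End K M) m) := by
    intro a b m
    rw [zpow_add, Units.val_mul, Module.End.mul_apply]
  have h1 : ((U ^ (1 : ℤ) : (Module.End K M)ˣ) : Module.End K M) = D := by rw [zpow_one]
  have h2 : ((U ^ (-1 : ℤ) : (Module.End K M)ˣ) : Module.End K M) = J := by rw [zpow_neg_one]; rfl
  refine ⟨fun n => ((U ^ n : (Module.End K M)ˣ) : Module.End K M), h1, h2, by simp, hadd, ?_⟩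
  intro n
  induction n using Int.induction_on with
  | zero => simp
  | succ i ih =>
    intro m
    simp only at ih ⊢
    rw [add_comm (i : ℤ) 1, hadd, hadd, ih, h1, map_add, R.Dh, map_smul]
    push_cast
    rw [add_smul, one_smul, add_assoc]
  | pred i ih =>
    intro m
    simp only at ih ⊢
    rw [sub_eq_add_neg, add_comm (-(i : ℤ)) (-1), hadd, hadd, ih, h2, map_add, map_smul, R.hJ]
    push_cast
    rw [add_smul, neg_smul 1, one_smul]
    abel

end Relations

theorem shift_mem_maxGenEigenspace {T : Module.End K M} {c : K}
    (hT : ∀ m, T (h m) = h (T m) + c • T m) {μ : K} {m : M} (hm : m ∈ h.maxGenEigenspace μ) :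
    T m ∈ h.maxGenEigenspace (μ - c) := by
  obtain ⟨k, hk⟩ := (Module.End.mem_maxGenEigenspace _ _ _).1 hm
  refine (Module.End.mem_maxGenEigenspace _ _ _).2 ⟨k, ?_⟩
  have : ∀ (k : ℕ) (y : M), ((h - (μ - c) • 1) ^ k) (T y) = T (((h - μ • 1) ^ k) y) := by
    intro k
    induction k with
    | zero => simp
    | succ k ih =>
      intro y
      rw [pow_succ, Module.End.mul_apply, pow_succ, Module.End.mul_apply, ← ih]
      congr 1
      simp only [LinearMap.sub_apply, LinearMap.smul_apply, Module.End.one_apply, map_sub, hT,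
        map_smul, sub_smul]
      abel
  rw [this, hk, map_zero]

theorem map_mem_maxGenEigenspace {μ : K} {m : M} (hm : m ∈ h.maxGenEigenspace μ) :
    h m ∈ h.maxGenEigenspace μ :=
  Module.End.mapsTo_maxGenEigenspace_of_comm (Commute.refl h) μ hm

/-- The weights of an indecomposable module lie in one coset of the integers. -/
theorem Relations.weight_mem_coset (R : Relations D J h)
    (hsup : ⨆ μ, h.maxGenEigenspace μ = ⊤) (hind : Indecomp D J h) {c : K}
    (hc : h.maxGenEigenspace c ≠ ⊥) {μ : K} (hμ : h.maxGenEigenspace μ ≠ ⊥) :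
    ∃ n : ℤ, μ = c + n := by
  let s : Set K := {μ | ∃ n : ℤ, μ = c + n}
  -- `D` and `J` shift weights by `-1` and `+1`, so the coset `s` and its complement split the
  -- module into two stable halves.
  have hst : ∀ r : Set K, (∀ μ ∈ r, μ - 1 ∈ r ∧ μ + 1 ∈ r) →
      Stable D J h (⨆ μ ∈ r, h.maxGenEigenspace μ) := by
    intro r hr m hm
    have hsub : ∀ μ ∈ r, h.maxGenEigenspace μ ≤ ⨆ μ ∈ r, h.maxGenEigenspace μ := fun μ hμ =>
      le_iSup₂_of_le μ hμ le_rfl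
    have key : ∀ T : Module.End K M,
        (∀ μ ∈ r, ∀ m ∈ h.maxGenEigenspace μ, T m ∈ ⨆ μ ∈ r, h.maxGenEigenspace μ) →
        T m ∈ ⨆ μ ∈ r, h.maxGenEigenspace μ := by
      intro T hT
      have : (⨆ μ ∈ r, h.maxGenEigenspace μ) ≤ (⨆ μ ∈ r, h.maxGenEigenspace μ).comap T :=
        iSup₂_le fun μ hμ m hm => hT μ hμ m hm
      exact this hm
    refine ⟨key D fun μ hμ m hm => ?_, key J fun μ hμ m hm => ?_, key h fun μ hμ m hm => ?_⟩
    · exact hsub _ (hr μ hμ).1 (shift_mem_maxGenEigenspace (c := 1) (by simpa using R.Dh) hm)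
    · have := shift_mem_maxGenEigenspace (h := h) (T := J) (c := -1)
        (fun m => by rw [R.hJ, neg_smul, one_smul]; abel) hm
      rw [sub_neg_eq_add] at this
      exact hsub _ (hr μ hμ).2 this
    · exact hsub _ hμ (map_mem_maxGenEigenspace hm)
  have hs : ∀ μ ∈ s, μ - 1 ∈ s ∧ μ + 1 ∈ s := by
    rintro _ ⟨n, rfl⟩
    exact ⟨⟨n - 1, by push_cast; ring⟩, ⟨n + 1, by push_cast; ring⟩⟩
  have hs' : ∀ μ ∈ sᶜ, μ - 1 ∈ sᶜ ∧ μ + 1 ∈ sᶜ := fun μ hμ =>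
    ⟨fun hh => hμ (by simpa using (hs _ hh).2), fun hh => hμ (by simpa using (hs _ hh).1)⟩
  have hcompl : IsCompl (⨆ μ ∈ s, h.maxGenEigenspace μ) (⨆ μ ∈ sᶜ, h.maxGenEigenspace μ) := by
    refine ⟨h.independent_maxGenEigenspace.disjoint_biSup_biSup disjoint_compl_right, ?_⟩
    rw [codisjoint_iff, eq_top_iff, ← hsup]
    refine iSup_le fun μ => ?_
    by_cases hμ : μ ∈ s
    · exact le_sup_of_le_left (le_iSup₂_of_le μ hμ le_rfl)
    · exact le_sup_of_le_right (le_iSup₂_of_le μ hμ le_rfl)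
  by_contra hcon
  rcases hind _ _ (hst s hs) (hst sᶜ hs') hcompl with h0 | h0
  · exact hc (eq_bot_iff.2 (h0 ▸ le_iSup₂_of_le c ⟨0, by simp⟩ le_rfl))
  · exact hμ (eq_bot_iff.2 (h0 ▸ le_iSup₂_of_le μ hcon le_rfl))

/-- If differentiation is injective, then the invariant subspaces form a chain. -/
theorem Relations.chain_of_injective [CharZero K] (R : Relations D J h)
    (hsup : ⨆ μ, h.maxGenEigenspace μ = ⊤) (hind : Indecomp D J h)
    (hinj : ∀ m, D m = 0 → m = 0) {S S' : Submodule K M} (hS : Stable D J h S)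
    (hS' : Stable D J h S') : S ≤ S' ∨ S' ≤ S := by
  by_cases hall : ∀ c, h.maxGenEigenspace c = ⊥
  · left
    have : (⊤ : Submodule K M) = ⊥ := by rw [← hsup]; simp [hall]
    exact (le_top.trans this.le).trans bot_le
  push Not at hall
  obtain ⟨c, hc⟩ := hall
  obtain ⟨T, hT1, hTn, hT0, hTadd, hTh⟩ := R.exists_zpow hinj
  have hTmem : ∀ (n : ℤ) {μ : K} {m : M}, m ∈ h.maxGenEigenspace μ →
      T n m ∈ h.maxGenEigenspace (μ - n) := fun n _ _ hm => shift_mem_maxGenEigenspace (hTh n) hm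
  have hTinv : ∀ n m, T (-n) (T n m) = m := fun n m => by rw [← hTadd, neg_add_cancel, hT0]
  have hTinv' : ∀ n m, T n (T (-n) m) = m := fun n m => by rw [← hTadd, add_neg_cancel, hT0]
  have hTst : ∀ {A : Submodule K M}, Stable D J h A → ∀ (n : ℤ), ∀ m ∈ A, T n m ∈ A := by
    intro A hA n
    induction n using Int.induction_on with
    | zero => intro m hm; rwa [hT0]
    | succ i ih =>
      intro m hm
      rw [add_comm, hTadd, hT1]
      exact (hA _ (ih m hm)).1
    | pred i ih =>
      intro m hm
      rw [sub_eq_add_neg, add_comm, hTadd, hTn]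
      exact (hA _ (ih m hm)).2.1
  -- A stable subspace is determined by its part of weight `c`.
  have hle : ∀ A B : Submodule K M, Stable D J h A → Stable D J h B →
      A ⊓ h.maxGenEigenspace c ≤ B → A ≤ B := by
    intro A B hA hB hAB m hm
    have h1 : ⨆ μ, A ⊓ h.maxGenEigenspace μ ≤ B := by
      refine iSup_le fun μ a ha => ?_
      by_cases ha0 : a = 0
      · rw [ha0]; exact B.zero_mem
      obtain ⟨n, hn⟩ := R.weight_mem_coset hsup hind hc (μ := μ)
        (fun h0 => ha0 ((Submodule.mem_bot K).1 (h0 ▸ ha.2)))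
      have h2 : T n a ∈ B := hAB ⟨hTst hA n a ha.1, by
        have := hTmem n ha.2
        rwa [hn, add_sub_cancel_right] at this⟩
      rw [← hTinv n a]
      exact hTst hB _ _ h2
    exact h1 (mem_iSup_inf_maxGenEigenspace hsup (fun x hx => (hA x hx).2.2) hm)
  let V := h.maxGenEigenspace c
  let W := ⨆ μ ∈ ({c}ᶜ : Set K), h.maxGenEigenspace μ
  have hVW : IsCompl V W := by
    constructor
    · have := h.independent_maxGenEigenspace.disjoint_biSup_biSup
        (disjoint_compl_right (a := ({c} : Set K)))
      simpa [V, W] using this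
    · rw [codisjoint_iff, eq_top_iff, ← hsup]
      refine iSup_le fun μ => ?_
      by_cases hμ : μ = c
      · rw [hμ]; exact le_sup_left
      · exact le_sup_of_le_right (le_iSup₂_of_le μ hμ le_rfl)
  let p : M →ₗ[K] V := V.projectionOnto W hVW
  have hpV : ∀ m (hm : m ∈ V), p m = ⟨m, hm⟩ := fun m hm =>
    Submodule.projectionOnto_apply_of_mem_left hVW hm
  have hpμ : ∀ μ, μ ≠ c → ∀ m ∈ h.maxGenEigenspace μ, p m = 0 := fun μ hμ m hm =>
    (Submodule.projectionOnto_apply_eq_zero_iff hVW).2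
      ((le_iSup₂_of_le (f := fun μ (_ : μ ∈ ({c}ᶜ : Set K)) => h.maxGenEigenspace μ)
        μ hμ le_rfl) hm)
  have htV : ∀ m ∈ V, (h - c • 1 : Module.End K M) m ∈ V := fun m hm =>
    V.sub_mem (map_mem_maxGenEigenspace hm) (V.smul_mem c hm)
  let t : Module.End K V := (h - c • 1 : Module.End K M).restrict htV
  have ht : ∀ a : V, (t a : M) = h a - c • (a : M) := fun a => rfl
  have hph : ∀ m, p (h m) = t (p m) + c • p m := by
    intro m
    have hm : m ∈ ⨆ μ, h.maxGenEigenspace μ := hsup ▸ Submodule.mem_top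
    induction hm using Submodule.iSup_induction' with
    | zero => simp
    | add x y _ _ hx hy => rw [map_add, map_add, hx, hy, map_add, map_add, smul_add]; abel
    | mem μ x hx =>
      by_cases hμ : μ = c
      · subst hμ
        rw [hpV x hx, hpV _ (map_mem_maxGenEigenspace hx)]
        ext
        simp [ht]
      · rw [hpμ μ hμ _ hx, hpμ μ hμ _ (map_mem_maxGenEigenspace hx)]
        simp
  have htnil : ∀ a : V, ∃ n, (t ^ n) a = 0 := by
    intro a
    obtain ⟨k, hk⟩ := (Module.End.mem_maxGenEigenspace _ _ _).1 a.2
    refine ⟨k, ?_⟩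
    have : ∀ k, ((((t ^ k) a : V)) : M) = ((h - c • 1) ^ k) (a : M) := by
      intro k
      induction k with
      | zero => simp
      | succ k ih => rw [pow_succ', Module.End.mul_apply, pow_succ', Module.End.mul_apply, ← ih]; rfl
    ext
    rw [this, hk]; rfl
  -- `N A` consists of the vectors all of whose weight components, shifted back to weight `c`, lie
  -- in `A`. It transports a decomposition of `V` to one of `M`.
  let N : Submodule K V → Submodule K M := fun A => ⨅ n : ℤ, A.comap (p ∘ₗ T n)
  have hN : ∀ A m, m ∈ N A ↔ ∀ n, p (T n m) ∈ A := fun A m => by simp [N]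
  have hNst : ∀ A : Submodule K V, (∀ a ∈ A, t a ∈ A) → Stable D J h (N A) := by
    intro A hA m hm
    rw [hN] at hm
    simp only [hN]
    refine ⟨fun n => ?_, fun n => ?_, fun n => ?_⟩
    · rw [← hT1, ← hTadd]; exact hm _
    · rw [← hTn, ← hTadd]; exact hm _
    · rw [hTh, map_add, map_smul, hph]
      exact A.add_mem (A.add_mem (hA _ (hm n)) (A.smul_mem _ (hm n))) (A.smul_mem _ (hm n))
  have hbot : Stable D J h (⊥ : Submodule K M) := fun m hm => by
    rw [Submodule.mem_bot] at hm; simp [hm]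
  have hNmem : ∀ (A : Submodule K V) (a : V), a ∈ A → ∀ n, T n a ∈ N A := by
    intro A a ha n
    rw [hN]
    intro k
    rw [← hTadd]
    by_cases hk : k + n = 0
    · rw [hk, hT0, hpV _ a.2]; exact ha
    · rw [hpμ _ _ _ (hTmem (k + n) a.2)]
      · exact A.zero_mem
      · rw [ne_eq, sub_eq_self]
        exact_mod_cast hk
  have hVind : ∀ A B : Submodule K V, (∀ a ∈ A, t a ∈ A) → (∀ a ∈ B, t a ∈ B) → IsCompl A B →
      A = ⊥ ∨ B = ⊥ := by
    intro A B hA hB hAB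
    have hcompl : IsCompl (N A) (N B) := by
      constructor
      · rw [disjoint_iff, eq_bot_iff]
        have h1 : N A ⊓ N B = N ⊥ := by
          ext m
          rw [Submodule.mem_inf, hN, hN, hN, ← hAB.inf_eq_bot, ← forall_and]
          rfl
        rw [h1]
        refine hle _ _ (hNst ⊥ fun a ha => by rw [Submodule.mem_bot] at ha ⊢; simp [ha]) hbot ?_
        rintro m ⟨hm, hmV⟩
        have := (hN _ _).1 hm 0
        rw [hT0, hpV m hmV, Submodule.mem_bot] at this
        exact congrArg Subtype.val this
      · rw [codisjoint_iff, eq_top_iff, ← hsup]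
        refine iSup_le fun μ m hm => ?_
        by_cases hm0 : m = 0
        · rw [hm0]; exact Submodule.zero_mem _
        obtain ⟨n, hn⟩ := R.weight_mem_coset hsup hind hc (μ := μ)
          (fun h0 => hm0 ((Submodule.mem_bot K).1 (h0 ▸ hm)))
        have hTm : T n m ∈ V := by
          have := hTmem n hm
          rwa [hn, add_sub_cancel_right] at this
        obtain ⟨a, ha, b, hb, hab⟩ := Submodule.mem_sup.1
          (hAB.sup_eq_top ▸ Submodule.mem_top : (⟨T n m, hTm⟩ : V) ∈ A ⊔ B)
        have hab' : (a : M) + b = T n m := congrArg Subtype.val hab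
        rw [← hTinv n m, ← hab', map_add]
        exact Submodule.add_mem_sup (hNmem A a ha _) (hNmem B b hb _)
    have hNbot : ∀ A : Submodule K V, N A = ⊥ → A = ⊥ := by
      intro A hA
      refine eq_bot_iff.2 fun a ha => ?_
      have := hNmem A a ha 0
      rw [hT0, hA, Submodule.mem_bot] at this
      exact (Submodule.mem_bot K).2 (Subtype.ext this)
    exact (hind _ _ (hNst A hA) (hNst B hB) hcompl).imp (hNbot A) (hNbot B)
  have hinv : ∀ A : Submodule K M, Stable D J h A →
      ∀ a ∈ A.comap V.subtype, t a ∈ A.comap V.subtype := fun A hA a ha =>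
    A.sub_mem (hA _ ha).2.2 (A.smul_mem c ha)
  refine (chain_of_locally_nilpotent htnil hVind (hinv S hS) (hinv S' hS')).imp
    (fun hh => hle S S' hS hS' ?_) (fun hh => hle S' S hS' hS ?_)
  · rintro m ⟨hm, hmV⟩; exact hh (x := ⟨m, hmV⟩) hm
  · rintro m ⟨hm, hmV⟩; exact hh (x := ⟨m, hmV⟩) hm

theorem Relations.chain [CharZero K] (R : Relations D J h)
    (hsup : ⨆ μ, h.maxGenEigenspace μ = ⊤) (hind : Indecomp D J h) {S S' : Submodule K M}
    (hS : Stable D J h S) (hS' : Stable D J h S') : S ≤ S' ∨ S' ≤ S := by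
  by_cases hinj : ∀ m, D m = 0 → m = 0
  · exact R.chain_of_injective hsup hind hinj hS hS'
  · push Not at hinj
    obtain ⟨v, hDv, hv⟩ := hinj
    rcases R.simple_of_ker hsup hind hv hDv hS with h0 | h0
    · exact Or.inl (h0 ▸ bot_le)
    · exact Or.inr (h0 ▸ le_top)

end Shift

/-! ### Identities in the algebra and transfer to its modules -/

section Algebra

variable (K : Type*) [Field K]

/-- The element `∫` of the algebra. -/
noncomputable def int : I₁ K :=
  ⟨integration K, Algebra.subset_adjoin (by simp)⟩

variable {K}

theorem integration_monomial (n : ℕ) (a : K) :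
    integration K (monomial n a) = monomial (n + 1) (((n : K) + 1)⁻¹ * a) := by
  simp [integration, Polynomial.lsum_apply, Polynomial.sum_monomial_index, smul_monomial]

theorem mulX_monomial (n : ℕ) (a : K) : mulX K (monomial n a) = monomial (n + 1) a := by
  simp [mulX, X_mul_monomial]

theorem coe_H_monomial (n : ℕ) (a : K) :
    (H K : Module.End K K[X]) (monomial n a) = monomial n (((n : K) + 1) * a) := by
  change derivative (mulX K (monomial n a)) = _
  rw [mulX_monomial, derivative_monomial]
  simp [mul_comm]

theorem ext_monomial {a b : I₁ K}
    (hab : ∀ n c, (a : Module.End K K[X]) (monomial n c) = (b : Module.End K K[X]) (monomial n c)) :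
    a = b :=
  Subtype.ext (Polynomial.lhom_ext' fun n => LinearMap.ext fun c => hab n c)

theorem stable_restrictScalars {M : Type*} [AddCommGroup M] [Module K M] [Module (I₁ K) M]
    [IsScalarTower K (I₁ K) M] (S : Submodule (I₁ K) M) :
    Stable (Algebra.lsmul K K M (del K)) (Algebra.lsmul K K M (int K))
      (Algebra.lsmul K K M (H K)) (S.restrictScalars K) := fun _ hm =>
  ⟨S.smul_mem _ hm, S.smul_mem _ hm, S.smul_mem _ hm⟩

variable [CharZero K]

theorem del_mul_int : del K * int K = 1 := by
  refine ext_monomial fun n c => ?_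
  change derivative (integration K (monomial n c)) = monomial n c
  have : (n : K) + 1 ≠ 0 := Nat.cast_add_one_ne_zero n
  rw [integration_monomial, derivative_monomial]
  congr 1
  push_cast
  field_simp

theorem int_mul_H : int K * H K = x K := by
  refine ext_monomial fun n c => ?_
  change integration K ((H K : Module.End K K[X]) (monomial n c)) = mulX K (monomial n c)
  have : (n : K) + 1 ≠ 0 := Nat.cast_add_one_ne_zero n
  rw [coe_H_monomial, integration_monomial, mulX_monomial]
  congr 1
  field_simp

theorem del_mul_H : del K * H K = H K * del K + del K := by
  refine ext_monomial fun n c => ?_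
  change derivative ((H K : Module.End K K[X]) (monomial n c)) =
    (H K : Module.End K K[X]) (derivative (monomial n c)) + derivative (monomial n c)
  rw [coe_H_monomial, derivative_monomial, derivative_monomial, coe_H_monomial, ← map_add]
  rcases n with - | n
  · simp
  · congr 1
    simp
    ring

theorem H_mul_int : H K * int K = int K * H K + int K := by
  refine ext_monomial fun n c => ?_
  change (H K : Module.End K K[X]) (integration K (monomial n c)) =
    integration K ((H K : Module.End K K[X]) (monomial n c)) + integration K (monomial n c)
  have : (n : K) + 1 ≠ 0 := Nat.cast_add_one_ne_zero n
  rw [coe_H_monomial, integration_monomial, integration_monomial, coe_H_monomial, ← map_add]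
  congr 1
  push_cast
  field_simp

theorem H_mul_one_sub : H K * (1 - int K * del K) = 1 - int K * del K := by
  refine ext_monomial fun n c => ?_
  change (H K : Module.End K K[X]) (monomial n c - integration K (derivative (monomial n c))) =
    monomial n c - integration K (derivative (monomial n c))
  rw [derivative_monomial, integration_monomial, map_sub, coe_H_monomial, coe_H_monomial]
  rcases n with - | n
  · simp
  · have : (n : K) + 1 ≠ 0 := Nat.cast_add_one_ne_zero n
    have h2 : ((n : K) + 1)⁻¹ * (c * ((n : K) + 1)) = c := by field_simp
    simp [h2]

section Modules

variable {M : Type*} [AddCommGroup M] [Module K M] [Module (I₁ K) M] [IsScalarTower K (I₁ K) M]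

theorem relations_lsmul : Relations (Algebra.lsmul K K M (del K)) (Algebra.lsmul K K M (int K))
    (Algebra.lsmul K K M (H K)) where
  DJ m := by
    simp only [Algebra.lsmul_coe]
    rw [← mul_smul, del_mul_int, one_smul]
  Dh m := by
    simp only [Algebra.lsmul_coe]
    rw [← mul_smul, del_mul_H, add_smul, mul_smul]
  hJ m := by
    simp only [Algebra.lsmul_coe]
    rw [← mul_smul, H_mul_int, add_smul, mul_smul]
  he m := by
    simp only [Algebra.lsmul_coe]
    have : m - int K • del K • m = (1 - int K * del K) • m := by
      refine Eq.trans ?_ (sub_smul (1 : I₁ K) (int K * del K) m).symm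
      rw [one_smul, mul_smul]
    rw [this, ← mul_smul, H_mul_one_sub]

/-- Stability need only be checked on generators, and `x` is covered by `int_mul_H`. -/
theorem exists_restrictScalars_eq {S : Submodule K M}
    (hS : Stable (Algebra.lsmul K K M (del K)) (Algebra.lsmul K K M (int K))
      (Algebra.lsmul K K M (H K)) S) :
    ∃ N : Submodule (I₁ K) M, N.restrictScalars K = S := by
  have key : ∀ (a : Module.End K K[X]) (ha : a ∈ I₁ K), ∀ m ∈ S, (⟨a, ha⟩ : I₁ K) • m ∈ S := by
    intro a ha
    induction ha using Algebra.adjoin_induction with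
    | mem b hb =>
      intro m hm
      rcases hb with rfl | rfl | rfl
      · have : x K • m ∈ S := by
          rw [← int_mul_H, mul_smul]
          exact (hS _ (hS m hm).2.2).2.1
        exact this
      · exact (hS m hm).1
      · exact (hS m hm).2.1
    | algebraMap r =>
      intro m hm
      have : algebraMap K (I₁ K) r • m ∈ S := by
        rw [algebraMap_smul]
        exact S.smul_mem r hm
      exact this
    | add b c hb hc ihb ihc =>
      intro m hm
      have : ((⟨b, hb⟩ : I₁ K) + ⟨c, hc⟩) • m ∈ S := by
        rw [add_smul]
        exact S.add_mem (ihb m hm) (ihc m hm)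
      exact this
    | mul b c hb hc ihb ihc =>
      intro m hm
      have : ((⟨b, hb⟩ : I₁ K) * ⟨c, hc⟩) • m ∈ S := by
        rw [mul_smul]
        exact ihb _ (ihc m hm)
      exact this
  exact ⟨{ S with smul_mem' := fun a m hm => key a.1 a.2 m hm }, rfl⟩

theorem indecomp_lsmul (hind : IsIndecomposable (I₁ K) M) :
    Indecomp (Algebra.lsmul K K M (del K)) (Algebra.lsmul K K M (int K))
      (Algebra.lsmul K K M (H K)) := by
  intro A B hA hB hAB
  obtain ⟨A, rfl⟩ := exists_restrictScalars_eq hA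
  obtain ⟨B, rfl⟩ := exists_restrictScalars_eq hB
  have hcompl : IsCompl A B := by
    constructor
    · rw [Submodule.disjoint_def]
      exact fun m ha hb => Submodule.disjoint_def.1 hAB.disjoint m ha hb
    · rw [codisjoint_iff, eq_top_iff]
      intro m _
      obtain ⟨a, ha, b, hb, rfl⟩ := Submodule.mem_sup.1
        (hAB.sup_eq_top ▸ Submodule.mem_top : m ∈ A.restrictScalars K ⊔ B.restrictScalars K)
      exact Submodule.add_mem_sup ha hb
  exact (hind.2 A B hcompl).imp (fun h => by rw [h, Submodule.restrictScalars_bot])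
    (fun h => by rw [h, Submodule.restrictScalars_bot])

end Modules

end Algebra

end IntegroDiff

theorem mainTheorem6 {K : Type*} [Field K] [CharZero K]
    {M : Type*} [AddCommGroup M] [Module K M] [Module (IntegroDiff.I₁ K) M]
    [IsScalarTower K (IntegroDiff.I₁ K) M]
    (hM : IntegroDiff.IsGenWeight K M)
    (hind : IntegroDiff.IsIndecomposable (IntegroDiff.I₁ K) M) :
    IntegroDiff.IsUniserial (IntegroDiff.I₁ K) M := by
  classical
  intro N L
  exact IntegroDiff.relations_lsmul.chain hM.submodule_iSup_eq_top
    (IntegroDiff.indecomp_lsmul hind) (IntegroDiff.stable_restrictScalars N)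
    (IntegroDiff.stable_restrictScalars L)
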